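/- Let $\kappa$ be a strongly inaccessible cardinal (uncountable, regular, strong limit) and let $\theta$ be an ordinal with $2\le\theta<\kappa$. Then $\mathrm{HL}_{1,\theta}(\kappa)$ holds, that is: writing ${}^{\kappa>}2=\bigcup_{\alpha<\kappa}{}^{\alpha}2$ for the tree of binary sequences of length less than $\kappa$, ordered by initial segment $\trianglelefteq$, and $\lg(\eta)$ for the length of $\eta$, for every coloring $c:{}^{\kappa>}2\to\theta$ there are a set $A\subseteq\kappa$ of cardinality $\kappa$ and a non-empty set $T\subseteq{}^{\kappa>}2$, closed under initial segments, such that: 1. for all $\eta\in T$ and $\alpha<\kappa$ there is $\nu\in T$ with $\eta\trianglelefteq\nu$ and $\lg(\nu)=\max\{\lg(\eta),\alpha\}$; 2. if $\delta<\kappa$ is a limit ordinal and $\eta\in{}^{\delta}2$ satisfies $\eta\restriction\alpha\in T$ for all $\alpha<\delta$, then $\eta\in T$; 3. for every $\eta\in T$, both $\eta^{\frown}\langle0\rangle$ and $\eta^{\frown}\langle1\rangle$ belong to $T$ if and only if $\lg(\eta)\in A$; 4. $c$ is constant on $\{\eta\in T:\lg(\eta)\in A\}$ (one color for all levels in $A$).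 -/

import Mathlib

universe u

namespace HalpernLauchli

open Ordinal Cardinal

/-- `Pow2 α` is the set of functions from the ordinal `α` to `2 = {0, 1}`. -/
abbrev Pow2 (α : Ordinal.{u}) : Type (u + 1) := Set.Iio α → Bool

/-- Transfinite binary sequences: an ordinal `lg` together with a function from `lg` to `2`. -/
structure BinSeq : Type (u + 1) where
  /-- the length -/
  lg : Ordinal.{u}
  /-- the entries -/
  val : Pow2 lg

namespace BinSeq

/-- `η` is an initial segment of `ν` (possibly equal to `ν`). -/
def IsInitSeg (η ν : BinSeq.{u}) : Prop :=
  ∃ h : η.lg ≤ ν.lg, ∀ β : Set.Iio η.lg, η.val β = ν.val ⟨β.1, lt_of_lt_of_le β.2 h⟩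

/-- The restriction of `η` to an ordinal `α ≤ lg η`. -/
def restrict (η : BinSeq.{u}) (α : Ordinal.{u}) (h : α ≤ η.lg) : BinSeq.{u} :=
  ⟨α, fun β => η.val ⟨β.1, lt_of_lt_of_le β.2 h⟩⟩

open Classical in
/-- The sequence `η ⌢ ⟨i⟩` of length `lg η + 1`. -/
noncomputable def snoc (η : BinSeq.{u}) (i : Bool) : BinSeq.{u} :=
  ⟨η.lg + 1, fun β => if h : β.1 < η.lg then η.val ⟨β.1, h⟩ else i⟩

end BinSeq

/-- `T` is a subtree of the tree of binary sequences of length `< κ`: a non-empty set of such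
sequences that is closed under initial segments. -/
structure IsSubtree (κ : Ordinal.{u}) (T : Set BinSeq.{u}) : Prop where
  lg_lt : ∀ η ∈ T, η.lg < κ
  nonempty : T.Nonempty
  closed : ∀ η ∈ T, ∀ ν : BinSeq.{u}, ν.IsInitSeg η → ν ∈ T

/-- `T` is a regular subtree of the tree of binary sequences of length `< κ`. -/
structure IsRegularSubtree (κ : Ordinal.{u}) (T : Set BinSeq.{u}) : Prop
    extends IsSubtree κ T where
  /-- every node has extensions in `T` of every larger length `< κ` -/
  extend : ∀ η ∈ T, ∀ α < κ, ∃ ν ∈ T, η.IsInitSeg ν ∧ ν.lg = max η.lg α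
  /-- `T` is closed under limits of branches of limit length `< κ` -/
  limit : ∀ η : BinSeq.{u}, Order.IsSuccLimit η.lg → η.lg < κ →
    (∀ (α : Ordinal.{u}) (h : α < η.lg), η.restrict α h.le ∈ T) → η ∈ T

/-- `HL n θ κ`: the strong-tree version of the Halpern–Läuchli theorem for `n` trees of height `κ`
and colorings into `θ`. The coloring `c` is defined on all `n`-tuples of elements of `Pow2 α`, for
`α < κ`; it is meant for `1 ≤ n` and `2 ≤ θ`. -/
def HL (n : ℕ) (θ : Ordinal.{u}) (κ : Cardinal.{u}) : Prop :=
  ∀ c : (α : Set.Iio κ.ord) → (Fin n → Pow2 α.1) → Set.Iio θ,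
    ∃ (A : Set Ordinal.{u}) (T : Fin n → Set BinSeq.{u}),
      -- `A` is a subset of `κ` of cardinality `κ`
      (A ⊆ Set.Iio κ.ord ∧ #A = Cardinal.lift.{u + 1} κ) ∧
      (∀ l, IsRegularSubtree κ.ord (T l)) ∧
      -- the branching nodes of each tree are exactly those with length in `A`
      (∀ l, ∀ η ∈ T l, ((∀ i : Bool, η.snoc i ∈ T l) ↔ η.lg ∈ A)) ∧
      -- `c` is constant on the tuples of nodes of the trees of the same length `ε`, `ε ∈ A`
      ∃ i : Set.Iio θ, ∀ ε : Set.Iio κ.ord, ε.1 ∈ A →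
        ∀ η : Fin n → Pow2 ε.1, (∀ l, BinSeq.mk ε.1 (η l) ∈ T l) → c ε η = i

end HalpernLauchli

namespace HalpernLauchli

open Ordinal Cardinal Set

/-- The sequence that agrees with `x` below `α` and is `false` from `α` on. -/
noncomputable def trunc (α : Ordinal.{u}) (x : Ordinal.{u} → Bool) : Ordinal.{u} → Bool :=
  (Iio α).piecewise x fun _ => false

theorem trunc_apply {α β : Ordinal.{u}} (h : β < α) (x : Ordinal.{u} → Bool) :
    trunc α x β = x β :=
  piecewise_eq_of_mem _ _ _ h

theorem trunc_congr {α : Ordinal.{u}} {x y : Ordinal.{u} → Bool} (h : EqOn x y (Iio α)) :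
    trunc α x = trunc α y := by
  funext β
  by_cases hβ : β < α
  · rw [trunc_apply hβ, trunc_apply hβ, h hβ]
  · simp [trunc, hβ]

theorem trunc_trunc {α β : Ordinal.{u}} (h : α ≤ β) (x : Ordinal.{u} → Bool) :
    trunc α (trunc β x) = trunc α x :=
  trunc_congr fun _ hγ => trunc_apply (lt_of_lt_of_le hγ h) x

/-- Transfinite sequences can be defined by recursion on their initial segments. -/
theorem exists_eq_trunc (E : Ordinal.{u} → (Ordinal.{u} → Bool) → Bool) :
    ∃ x : Ordinal.{u} → Bool, ∀ β, x β = E β (trunc β x) := by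
  classical
  let F : ∀ β : Ordinal.{u}, (∀ γ, γ < β → Bool) → Bool :=
    fun β g => E β fun γ => if h : γ < β then g γ h else false
  refine ⟨lt_wf.fix F, fun β => ?_⟩
  rw [lt_wf.fix_eq F β]
  rfl

/-- Sets of ordinals can be defined by recursion on their initial segments. -/
theorem exists_set_eq_inter_Iio (P : Ordinal.{u} → Set Ordinal.{u} → Prop) :
    ∃ A : Set Ordinal.{u}, ∀ β, β ∈ A ↔ P β (A ∩ Iio β) := by
  let F : ∀ β : Ordinal.{u}, (∀ γ, γ < β → Prop) → Prop :=
    fun β g => P β {γ | ∃ h : γ < β, g γ h}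
  refine ⟨{β | lt_wf.fix F β}, fun β => ?_⟩
  rw [mem_ofPred_eq, lt_wf.fix_eq F β]
  have : {γ | ∃ _ : γ < β, lt_wf.fix F γ} = {β | lt_wf.fix F β} ∩ Iio β := by
    ext γ
    simp [and_comm]
  change P β {γ | ∃ _ : γ < β, lt_wf.fix F γ} ↔ _
  rw [this]

/-- Sequences of ordinals can be defined as suprema of images of their earlier terms. -/
theorem exists_eq_iSup_Iio (f : Ordinal.{u} → Ordinal.{u}) :
    ∃ b : Ordinal.{u} → Ordinal.{u}, ∀ j, b j = ⨆ k : Iio j, f (b k) := by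
  let F : ∀ j : Ordinal.{u}, (∀ k, k < j → Ordinal.{u}) → Ordinal.{u} :=
    fun j g => ⨆ k : Iio j, f (g k.1 k.2)
  exact ⟨lt_wf.fix F, fun j => lt_wf.fix_eq F j⟩

/-! ### Cardinal arithmetic below `κ` -/

theorem iSup_lt_ord_of_mk_lt {κ : Cardinal.{u}} (hκ : κ.IsRegular) {ι : Type (u + 1)}
    (hι : #ι < Cardinal.lift.{u + 1} κ) {f : ι → Ordinal.{u}} (hf : ∀ i, f i < κ.ord) :
    ⨆ i, f i < κ.ord := by
  refine Ordinal.lift_iSup_lt_of_lt_cof ?_ hf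
  rw [Cardinal.lift_ord, hκ.lift.cof_ord, Cardinal.lift_id'.{u, u + 1}]
  exact hι

theorem le_iSup_of_mk_lt {κ : Cardinal.{u}} {ι : Type (u + 1)}
    (hι : #ι < Cardinal.lift.{u + 1} κ) (f : ι → Ordinal.{u}) (i : ι) : f i ≤ ⨆ i, f i := by
  have : Small.{u} ι := by
    obtain ⟨c, hc⟩ := Cardinal.mem_range_lift_of_le hι.le
    exact Cardinal.small_iff_lift_mk_lt_univ.2 (by
      rw [← hc, Cardinal.lift_lift]; exact Cardinal.lift_lt_univ' c)
  exact le_ciSup (Ordinal.bddAbove_of_small) i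

theorem mk_Iio_lt_lift {κ : Cardinal.{u}} {α : Ordinal.{u}} (h : α < κ.ord) :
    #(Iio α) < Cardinal.lift.{u + 1} κ := by
  rw [Cardinal.mk_Iio_ordinal, Cardinal.lift_lt]
  exact Cardinal.lt_ord.1 h

theorem mk_pow2_lt_lift {κ : Cardinal.{u}} (hκ : κ.IsStrongPrelimit) {α : Ordinal.{u}}
    (h : α < κ.ord) : #(Pow2 α) < Cardinal.lift.{u + 1} κ := by
  rw [Cardinal.mk_arrow, Cardinal.mk_bool, Cardinal.mk_Iio_ordinal, Cardinal.lift_two,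
    Cardinal.lift_lift, ← Cardinal.lift_two_power, Cardinal.lift_lt]
  exact hκ (Cardinal.lt_ord.1 h)

/-- A subset of `κ` that is unbounded in the regular cardinal `κ` has cardinality `κ`. -/
theorem mk_eq_lift_of_unbounded {κ : Cardinal.{u}} (hκ : κ.IsRegular) {A : Set Ordinal.{u}}
    (hA : A ⊆ Iio κ.ord) (h : ∀ b < κ.ord, ∃ a ∈ A, b ≤ a) :
    #A = Cardinal.lift.{u + 1} κ := by
  refine le_antisymm ?_ (not_lt.1 fun hlt => ?_)
  · refine (Cardinal.mk_le_mk_of_subset hA).trans ?_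
    rw [Cardinal.mk_Iio_ordinal, Cardinal.card_ord]
  · have hlim := Cardinal.isSuccLimit_ord hκ.aleph0_le
    have hb := iSup_lt_ord_of_mk_lt hκ hlt
      (f := fun a : A => Order.succ a.1) fun a => hlim.succ_lt (hA a.2)
    obtain ⟨a, ha, hle⟩ := h _ hb
    exact (Order.succ_le_iff.1
      (le_iSup_of_mk_lt hlt (fun a : A => Order.succ a.1) ⟨a, ha⟩)).not_ge hle

/-! ### The dense color -/

/-- A color is dense above some node, uniformly in the level: there are a node `η` of length `l`
and a color `i` such that for every level `α` there is a level `ε ≥ α` at which all nodes of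
level `α` above `η` have an extension of color `i`. -/
theorem exists_uniformly_dense_color {κ : Cardinal.{u}} (hκ : κ.IsInaccessible)
    {θ : Ordinal.{u}} (hθ : θ < κ.ord) (c : Ordinal.{u} → (Ordinal.{u} → Bool) → Iio θ) :
    ∃ l < κ.ord, ∃ (η : Ordinal.{u} → Bool) (i : Iio θ), ∀ α < κ.ord, ∃ ε < κ.ord, α ≤ ε ∧
      ∀ y, EqOn y η (Iio l) → ∃ z, EqOn z y (Iio α) ∧ c ε z = i := by
  by_contra! H
  have hreg := hκ.isRegular
  -- a level that works for all nodes of length `l` and all colors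
  have step : ∀ l : Ordinal.{u}, ∃ f : Ordinal.{u}, l < κ.ord → f < κ.ord ∧
      ∀ (η : Ordinal.{u} → Bool) (i : Iio θ), ∀ ε < κ.ord, f ≤ ε →
        ∃ y, EqOn y η (Iio l) ∧ ∀ z, EqOn z y (Iio f) → c ε z ≠ i := by
    intro l
    by_cases hl : l < κ.ord
    swap
    · exact ⟨0, fun h => absurd h hl⟩
    choose g hg hg' using H l hl
    -- Strong limit: fewer than `κ` pairs of node and color, so by regularity one bound serves them
    -- all.
    have hι : #(Pow2 l × Iio θ) < Cardinal.lift.{u + 1} κ := by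
      rw [Cardinal.mk_prod, Cardinal.lift_id, Cardinal.lift_id]
      exact Cardinal.mul_lt_of_lt hreg.lift.aleph0_le
        (mk_pow2_lt_lift hκ.isStrongPrelimit hl) (mk_Iio_lt_lift hθ)
    let e : Pow2 l → Ordinal.{u} → Bool := fun p => Function.extend Subtype.val p fun _ => false
    let G : Pow2 l × Iio θ → Ordinal.{u} := fun p => g (e p.1) p.2
    refine ⟨⨆ p, G p, fun _ => ⟨iSup_lt_ord_of_mk_lt hreg hι fun p => hg _ _, ?_⟩⟩
    intro η i ε hε hle
    have hG : G (fun β => η β, i) ≤ ⨆ p, G p := le_iSup_of_mk_lt hι G _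
    obtain ⟨y, hy, hz⟩ := hg' (e fun β => η β) i ε hε (hG.trans hle)
    refine ⟨y, fun β hβ => (hy hβ).trans ?_, fun z hzy => hz z fun β hβ =>
      hzy (lt_of_lt_of_le hβ hG)⟩
    exact Subtype.val_injective.extend_apply _ _ (⟨β, hβ⟩ : Iio l)
  choose f hf using step
  obtain ⟨b, hb⟩ := exists_eq_iSup_Iio f
  have hle : ∀ {k j}, k < j → f (b k) ≤ b j := fun {k j} hkj => by
    rw [hb j]
    exact le_ciSup (f := fun k : Iio j => f (b k)) (Ordinal.bddAbove_of_small) ⟨k, hkj⟩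
  have hbκ : ∀ j, j < κ.ord → b j < κ.ord := by
    intro j
    induction j using WellFoundedLT.induction with | ind j ih
    intro hj
    rw [hb]
    exact iSup_lt_ord_of_mk_lt hreg (mk_Iio_lt_lift hj) fun k =>
      (hf _ (ih k k.2 (k.2.trans hj))).1
  -- The level `b θ` is above all blocks, so every color can be avoided at this one level.
  have hεκ := hbκ θ hθ
  have hext : ∀ (η : Ordinal.{u} → Bool) (j : Ordinal.{u}), ∃ y, ∀ hj : j < θ,
      EqOn y η (Iio (b j)) ∧ ∀ z, EqOn z y (Iio (f (b j))) → c (b θ) z ≠ ⟨j, hj⟩ := by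
    intro η j
    by_cases hj : j < θ
    · obtain ⟨y, hy⟩ := (hf _ (hbκ j (hj.trans hθ))).2 η ⟨j, hj⟩ _ hεκ (hle hj)
      exact ⟨y, fun _ => hy⟩
    · exact ⟨η, fun h => absurd h hj⟩
  choose E hE using hext
  -- the index of the block `[b j, f (b j))` that contains `β`
  let J : Ordinal.{u} → Ordinal.{u} := fun β => sInf {j | β < f (b j)}
  have hJ : ∀ {j β}, b j ≤ β → β < f (b j) → J β = j := fun {j β} h₁ h₂ => by
    refine le_antisymm (csInf_le' h₂) (not_lt.1 fun h => ?_)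
    have hm : β < f (b (J β)) := csInf_mem (s := {j | β < f (b j)}) ⟨j, h₂⟩
    exact (hm.trans_le (hle h)).not_ge h₁
  -- On block `j`, `x` follows the extension of its own restriction to `b j` that avoids color `j`.
  obtain ⟨x, hx⟩ := exists_eq_trunc fun β y => E (trunc (b (J β)) y) (J β) β
  obtain ⟨j, hj⟩ : ∃ j, c (b θ) x = j := ⟨_, rfl⟩
  obtain ⟨h₁, h₂⟩ := hE (trunc (b j) x) j j.2
  refine h₂ x (fun β hβ => ?_) hj
  rcases lt_or_ge β (b j) with h | h
  · exact ((h₁ h).trans (trunc_apply h x)).symm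
  · rw [hx β, hJ h hβ, trunc_trunc h]

namespace BinSeq

/-- The extension of a binary sequence to all ordinals by `false`. -/
noncomputable def toFun (η : BinSeq.{u}) : Ordinal.{u} → Bool :=
  Function.extend Subtype.val η.val fun _ => false

theorem toFun_apply (η : BinSeq.{u}) {β : Ordinal.{u}} (h : β < η.lg) :
    η.toFun β = η.val ⟨β, h⟩ :=
  Subtype.val_injective.extend_apply _ _ (⟨β, h⟩ : Iio η.lg)

theorem isInitSeg_iff {η ν : BinSeq.{u}} :
    η.IsInitSeg ν ↔ η.lg ≤ ν.lg ∧ EqOn η.toFun ν.toFun (Iio η.lg) := by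
  constructor
  · rintro ⟨h, h'⟩
    refine ⟨h, fun β hβ => ?_⟩
    rw [toFun_apply _ hβ, toFun_apply _ (lt_of_lt_of_le hβ h)]
    exact h' ⟨β, hβ⟩
  · rintro ⟨h, h'⟩
    refine ⟨h, fun β => ?_⟩
    have := h' β.2
    rwa [toFun_apply _ β.2, toFun_apply _ (lt_of_lt_of_le β.2 h)] at this

theorem restrict_toFun (η : BinSeq.{u}) {α : Ordinal.{u}} (h : α ≤ η.lg) :
    EqOn (η.restrict α h).toFun η.toFun (Iio α) := fun β hβ => by
  rw [toFun_apply _ (show β < (η.restrict α h).lg from hβ),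
    toFun_apply _ (lt_of_lt_of_le hβ h)]
  rfl

theorem snoc_toFun (η : BinSeq.{u}) (i : Bool) : EqOn (η.snoc i).toFun η.toFun (Iio η.lg) :=
  fun β hβ => by
    have hβ' : β < (η.snoc i).lg := lt_of_lt_of_le hβ (le_add_of_nonneg_right zero_le_one)
    rw [toFun_apply _ hβ', toFun_apply _ hβ]
    exact dif_pos hβ

theorem snoc_toFun_lg (η : BinSeq.{u}) (i : Bool) : (η.snoc i).toFun η.lg = i := by
  have h : η.lg < (η.snoc i).lg := Order.lt_add_one_iff.2 le_rfl
  rw [toFun_apply _ h]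
  exact dif_neg (lt_irrefl _)

end BinSeq

/-! ### Trees given by a rule -/

/-- The sequences of length `< κ` whose entries outside of `A` follow the rule `G`. -/
def ruleTree (κ : Ordinal.{u}) (A : Set Ordinal.{u})
    (G : Ordinal.{u} → (Ordinal.{u} → Bool) → Bool) : Set BinSeq.{u} :=
  {ρ | ρ.lg < κ ∧ ∀ β < ρ.lg, β ∉ A → ρ.toFun β = G β (trunc β ρ.toFun)}

section ruleTree

variable {κ : Ordinal.{u}} {A : Set Ordinal.{u}}
  {G : Ordinal.{u} → (Ordinal.{u} → Bool) → Bool}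

/-- Obeying the rule at `β` involves only entries up to `β`; hence closure under initial segments
and limits. -/
theorem rule_congr {x y : Ordinal.{u} → Bool} {α β : Ordinal.{u}} (h : EqOn x y (Iio α))
    (hβ : β < α) (hy : y β = G β (trunc β y)) : x β = G β (trunc β x) := by
  rw [h hβ, hy, trunc_congr fun γ hγ => h (lt_trans hγ hβ)]

theorem isRegularSubtree_ruleTree (hκ : 0 < κ) : IsRegularSubtree κ (ruleTree κ A G) where
  lg_lt _ h := h.1
  nonempty := ⟨⟨0, fun _ => false⟩, hκ, fun β hβ => absurd hβ not_lt_zero⟩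
  closed η hη ν hν := by
    obtain ⟨hle, heq⟩ := BinSeq.isInitSeg_iff.1 hν
    exact ⟨hle.trans_lt hη.1, fun β hβ hA => rule_congr heq hβ (hη.2 β (hβ.trans_le hle) hA)⟩
  extend η hη α hα := by
    classical
    -- Past `η`, `G` is followed even at levels in `A`, where any entry is allowed.
    obtain ⟨x, hx⟩ := exists_eq_trunc fun β y => if β < η.lg then η.toFun β else G β y
    have hxη : EqOn x η.toFun (Iio η.lg) := fun β hβ => (hx β).trans (if_pos hβ)
    let ν : BinSeq.{u} := ⟨max η.lg α, fun β => x β⟩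
    have hν : EqOn ν.toFun x (Iio ν.lg) := fun β hβ => ν.toFun_apply hβ
    have hle : η.lg ≤ ν.lg := le_max_left _ _
    refine ⟨ν, ⟨max_lt hη.1 hα, fun β hβ hA => rule_congr hν hβ ?_⟩,
      BinSeq.isInitSeg_iff.2 ⟨hle, fun β hβ => ?_⟩, rfl⟩
    · rcases lt_or_ge β η.lg with h | h
      · exact rule_congr hxη h (hη.2 β h hA)
      · rw [hx, if_neg h.not_gt]
    · rw [hν (lt_of_lt_of_le hβ hle), hxη hβ]
  limit η hlim hlt h := by
    refine ⟨hlt, fun β hβ hA => ?_⟩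
    have hβ' := hlim.succ_lt hβ
    have hs := Order.lt_succ β
    exact rule_congr (η.restrict_toFun hβ'.le).symm hs ((h _ hβ').2 β hs hA)

theorem forall_snoc_mem_ruleTree_iff (hκ : Order.IsSuccLimit κ) {η : BinSeq.{u}}
    (hη : η ∈ ruleTree κ A G) : (∀ i, η.snoc i ∈ ruleTree κ A G) ↔ η.lg ∈ A := by
  constructor
  · intro h
    by_contra hA
    have key : ∀ i, i = G η.lg (trunc η.lg η.toFun) := fun i => by
      have := (h i).2 η.lg (Order.lt_add_one_iff.2 le_rfl) hA
      rwa [η.snoc_toFun_lg, trunc_congr (η.snoc_toFun i)] at this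
    exact absurd ((key true).trans (key false).symm) (by decide)
  · intro hA i
    refine ⟨hκ.succ_lt hη.1, fun β hβ hβA => ?_⟩
    rcases (Order.lt_add_one_iff.1 hβ).lt_or_eq with h | rfl
    · exact rule_congr (η.snoc_toFun i) h (hη.2 β h hβA)
    · exact absurd hA hβA

end ruleTree

/-! ### Branching levels and the final tree -/

/-- Given a function `e` on levels, there are an unbounded set of levels and a function `s` such
that each level `ε` of the set is `e (s ε)`, where `s` is constant on the interval `[s ε, ε]`. -/
theorem exists_unbounded_levels {κ l : Ordinal.{u}} (hl : l < κ)
    (e : Ordinal.{u} → Ordinal.{u}) (he : ∀ α < κ, α ≤ e α ∧ e α < κ) :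
    ∃ (A : Set Ordinal.{u}) (s : Ordinal.{u} → Ordinal.{u}), A ⊆ Iio κ ∧
      (∀ b < κ, ∃ a ∈ A, b ≤ a) ∧
      ∀ ε ∈ A, l ≤ s ε ∧ s ε < κ ∧ e (s ε) = ε ∧
        ∀ β, s ε ≤ β → β ≤ ε → s β = s ε ∧ (β < ε → β ∉ A) := by
  let g : Set Ordinal.{u} → Ordinal.{u} := fun S => sInf {b | l ≤ b ∧ ∀ a ∈ S, a < b}
  have hg : ∀ {S b}, l ≤ b → (∀ a ∈ S, a < b) → l ≤ g S ∧ (∀ a ∈ S, a < g S) ∧ g S ≤ b :=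
    fun {S b} h₁ h₂ =>
      have h := csInf_mem (s := {b | l ≤ b ∧ ∀ a ∈ S, a < b}) ⟨b, h₁, h₂⟩
      ⟨h.1, h.2, csInf_le' ⟨h₁, h₂⟩⟩
  -- The next level is `e` of the least ordinal `≥ l` above all earlier levels.
  obtain ⟨A, hA⟩ := exists_set_eq_inter_Iio fun ε S => ε < κ ∧ e (g S) = ε
  have hAκ : A ⊆ Iio κ := fun ε hε => ((hA ε).1 hε).1
  refine ⟨A, fun ε => g (A ∩ Iio ε), hAκ, fun b hb => ?_, fun ε hε => ?_⟩
  -- If `A` were bounded, `e (g A)` would be a member of `A` above all of `A`.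
  · by_contra! hlt
    obtain ⟨h₁, h₂, h₃⟩ := hg (S := A) (le_max_left l b) fun a ha =>
      (hlt a ha).trans_le (le_max_right l b)
    obtain ⟨h₄, h₅⟩ := he (g A) (h₃.trans_lt (max_lt hl hb))
    have : A ∩ Iio (e (g A)) = A := inter_eq_left.2 fun a ha => (h₂ a ha).trans_le h₄
    exact (h₂ _ ((hA _).2 ⟨h₅, by rw [this]⟩)).not_ge h₄
  · obtain ⟨h₁, h₂, h₃⟩ := hg (S := A ∩ Iio ε) (le_max_left l ε) fun a ha =>
      lt_of_lt_of_le ha.2 (le_max_right l ε)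
    refine ⟨h₁, h₃.trans_lt (max_lt hl (hAκ hε)), ((hA ε).1 hε).2, fun β hβ hβε => ⟨?_, ?_⟩⟩
    · have : A ∩ Iio β = A ∩ Iio ε := by
        ext a
        exact ⟨fun h => ⟨h.1, lt_of_lt_of_le h.2 hβε⟩,
          fun h => ⟨h.1, (h₂ a h).trans_le hβ⟩⟩
      simp only [this]
    · exact fun hlt hmem => (h₂ β ⟨hmem, hlt⟩).not_ge hβ

/-- The one-dimensional case: all colorings of binary sequences of length `< κ` with fewer than `κ`
colors have a homogeneous strong subtree. -/
theorem exists_homogeneous_regularSubtree {κ : Cardinal.{u}} (hκ : κ.IsInaccessible)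
    {θ : Ordinal.{u}} (hθ : θ < κ.ord) (c : Ordinal.{u} → (Ordinal.{u} → Bool) → Iio θ)
    (hc : ∀ ε x y, EqOn x y (Iio ε) → c ε x = c ε y) :
    ∃ (A : Set Ordinal.{u}) (T : Set BinSeq.{u}),
      (A ⊆ Iio κ.ord ∧ #A = Cardinal.lift.{u + 1} κ) ∧ IsRegularSubtree κ.ord T ∧
      (∀ η ∈ T, (∀ i : Bool, η.snoc i ∈ T) ↔ η.lg ∈ A) ∧
      ∃ i, ∀ η ∈ T, η.lg ∈ A → c η.lg η.toFun = i := by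
  classical
  have hlim := Cardinal.isSuccLimit_ord hκ.aleph0_lt.le
  obtain ⟨l, hl, η, i, H⟩ := exists_uniformly_dense_color hκ hθ c
  have H' : ∀ α, ∃ ε, α < κ.ord → (α ≤ ε ∧ ε < κ.ord) ∧
      ∀ y, EqOn y η (Iio l) → ∃ z, EqOn z y (Iio α) ∧ c ε z = i := fun α => by
    by_cases hα : α < κ.ord
    · obtain ⟨ε, h₁, h₂, h₃⟩ := H α hα
      exact ⟨ε, fun _ => ⟨⟨h₂, h₁⟩, h₃⟩⟩
    · exact ⟨0, fun h => absurd h hα⟩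
  choose e he using H'
  have hz : ∀ α y, ∃ z, α < κ.ord → EqOn y η (Iio l) → EqOn z y (Iio α) ∧ c (e α) z = i :=
    fun α y => by
      by_cases h : α < κ.ord ∧ EqOn y η (Iio l)
      · obtain ⟨z, hz⟩ := (he α h.1).2 y h.2
        exact ⟨z, fun _ _ => hz⟩
      · exact ⟨y, fun h₁ h₂ => absurd ⟨h₁, h₂⟩ h⟩
  choose Z hZ using hz
  obtain ⟨A, s, hAκ, hA, hs⟩ := exists_unbounded_levels hl e fun α hα => (he α hα).1
  -- The stem is `η`; after it, the rule heads for color `i` from the restriction to `s β`.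
  let G : Ordinal.{u} → (Ordinal.{u} → Bool) → Bool :=
    fun β y => if β < l then η β else Z (s β) (trunc (s β) y) β
  have hlA : ∀ ε ∈ A, l ≤ ε := fun ε hε => by
    obtain ⟨h₁, h₂, h₃, -⟩ := hs ε hε
    exact h₁.trans ((he _ h₂).1.1.trans_eq h₃)
  refine ⟨A, ruleTree κ.ord A G, ⟨hAκ, mk_eq_lift_of_unbounded hκ.isRegular hAκ hA⟩,
    isRegularSubtree_ruleTree hlim.bot_lt, fun ρ => forall_snoc_mem_ruleTree_iff hlim,
    i, fun ρ hρ hρA => ?_⟩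
  obtain ⟨h₁, h₂, h₃, h₄⟩ := hs _ hρA
  have hle : s ρ.lg ≤ ρ.lg := (he _ h₂).1.1.trans_eq h₃
  have hη : EqOn (trunc (s ρ.lg) ρ.toFun) η (Iio l) := fun β hβ => by
    have hβl : β < l := hβ
    rw [trunc_apply (hβl.trans_le h₁), hρ.2 β (hβl.trans_le (h₁.trans hle))
      fun h => (hlA β h).not_gt hβl]
    exact if_pos hβl
  obtain ⟨h₅, h₆⟩ := hZ _ _ h₂ hη
  rw [h₃] at h₆
  rw [← h₆]
  refine hc _ _ _ fun β hβ => ?_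
  rcases lt_or_ge β (s ρ.lg) with h | h
  · exact ((h₅ h).trans (trunc_apply h _)).symm
  · obtain ⟨h₇, h₈⟩ := h₄ β h (le_of_lt hβ)
    rw [hρ.2 β hβ (h₈ hβ)]
    simp only [G]
    rw [if_neg (h₁.trans h).not_gt, h₇, trunc_trunc h]

end HalpernLauchli

theorem theorem1p4 (κ : Cardinal.{u}) (hκ : κ.IsInaccessible) (θ : Ordinal.{u})
    (hθ : 2 ≤ θ) (hθκ : θ < κ.ord) : HalpernLauchli.HL 1 θ κ := by
  classical
  intro c
  have hθ0 : 0 < θ := lt_of_lt_of_le two_pos hθ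
  obtain ⟨A, T, hA, hT, hsplit, i, hi⟩ :=
    HalpernLauchli.exists_homogeneous_regularSubtree hκ hθκ
      -- Levels from `κ` on get a dummy color.
      (fun ε x => if h : ε < κ.ord then c ⟨ε, h⟩ fun _ β => x β else ⟨0, hθ0⟩)
      fun ε x y hxy => by
        split_ifs
        · exact congrArg (c _) (funext fun _ => funext fun β => hxy β.2)
        · rfl
  refine ⟨A, fun _ => T, hA, fun _ => hT, fun _ => hsplit, i, fun ε hε η hη => ?_⟩
  have h := hi _ (hη 0) hε
  rw [dif_pos (show (HalpernLauchli.BinSeq.mk ε.1 (η 0)).lg < κ.ord from ε.2)] at h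
  rw [← h]
  congr 1
  funext k β
  rw [Subsingleton.elim k 0]
  exact ((HalpernLauchli.BinSeq.mk ε.1 (η 0)).toFun_apply β.2).symm
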